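/- **Definition.** Let $f$ be a real-valued function on a subset $U$ of $\mathbb{R}^n$. A sequence $(x_k)_{k\ge 0}$ in $U$ is a *BFGS sequence* for $f$ if $f$ is differentiable at each $x_k$ with $\nabla f(x_k)\neq 0$, and there exist parameters $0<\mu<\nu<1$ and a positive definite $n\times n$ matrix $H_0$ such that, with $$s_k=x_{k+1}-x_k,\qquad y_k=\nabla f(x_{k+1})-\nabla f(x_k),$$ $$W_k=I-\frac{s_ky_k^T}{s_k^Ty_k},\qquad H_{k+1}=W_kH_kW_k^T+\frac{s_ks_k^T}{s_k^Ty_k},$$ the following hold for all $k=0,1,2,\dots$: $$H_k\nabla f(x_k)\in-\mathbb{R}_+s_k,\qquad f(x_{k+1})\le f(x_k)+\mu\nabla f(x_k)^Ts_k,\qquad \nabla f(x_{k+1})^Ts_k\ge\nu\nabla f(x_k)^Ts_k .$$ (These conditions force $s_k^Ty_k>0$, so that the matrices $H_k$ are well defined.) **Theorem.** Let $U\subset\mathbb{R}^n$ be an open convex set containing a BFGS sequence $(x_k)$ for a convex function $f\colon U\to\mathbb{R}$. Assume that the level set $\{x\in U: f(x)\le f(x_0)\}$ is bounded, and that there is an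 open set $V\subset U$ that contains the closure (in $\mathbb{R}^n$) of the set of iterates $\{x_k : k\ge 0\}$, satisfies $\inf_V f=\inf_U f$, and throughout which the Hessian $\nabla^2 f$ exists, is continuous and is positive definite. Then $f$ attains its minimum over $U$, and $f(x_k)\to\min_U f$ as $k\to\infty$. -/

import Mathlib

open Filter Topology
open scoped Gradient

noncomputable section

/-- The BFGS update of an approximate inverse Hessian `H` for the step `s` and the gradient
increment `y`: with `W = I - s yᵀ / (sᵀ y)` it is `W H Wᵀ + s sᵀ / (sᵀ y)`. -/
def bfgsUpdate {n : ℕ} (H : Matrix (Fin n) (Fin n) ℝ) (s y : EuclideanSpace ℝ (Fin n)) :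
    Matrix (Fin n) (Fin n) ℝ :=
  (1 - (inner ℝ s y)⁻¹ • Matrix.vecMulVec s.ofLp y.ofLp) * H *
      (1 - (inner ℝ s y)⁻¹ • Matrix.vecMulVec s.ofLp y.ofLp).transpose +
    (inner ℝ s y)⁻¹ • Matrix.vecMulVec s.ofLp s.ofLp

/-- The matrices `H₀, H₁, …` generated from `H₀` along the sequence `x` by the BFGS updates with
`s_k = x_{k+1} - x_k` and `y_k = ∇f(x_{k+1}) - ∇f(x_k)`. -/
def bfgsMatrix {n : ℕ} (f : EuclideanSpace ℝ (Fin n) → ℝ) (x : ℕ → EuclideanSpace ℝ (Fin n))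
    (H₀ : Matrix (Fin n) (Fin n) ℝ) : ℕ → Matrix (Fin n) (Fin n) ℝ
  | 0 => H₀
  | k + 1 => bfgsUpdate (bfgsMatrix f x H₀ k) (x (k + 1) - x k) (∇ f (x (k + 1)) - ∇ f (x k))

/-- `x` is a BFGS sequence for `f`: the BFGS method could generate it using a line search
satisfying the Armijo and weak Wolfe conditions. -/
def IsBFGSSequence {n : ℕ} (f : EuclideanSpace ℝ (Fin n) → ℝ)
    (x : ℕ → EuclideanSpace ℝ (Fin n)) : Prop :=
  (∀ k, DifferentiableAt ℝ f (x k) ∧ ∇ f (x k) ≠ 0) ∧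
  ∃ (μ ν : ℝ) (H₀ : Matrix (Fin n) (Fin n) ℝ),
    0 < μ ∧ μ < ν ∧ ν < 1 ∧ H₀.PosDef ∧
    ∀ k,
      -- the step is a nonnegative multiple of the approximate Newton direction
      (∃ t : ℝ, 0 ≤ t ∧
        (bfgsMatrix f x H₀ k).mulVec (∇ f (x k)).ofLp = -(t • (x (k + 1) - x k).ofLp)) ∧
      -- Armijo condition
      f (x (k + 1)) ≤ f (x k) + μ * inner ℝ (∇ f (x k)) (x (k + 1) - x k) ∧
      -- weak Wolfe condition
      inner ℝ (∇ f (x (k + 1))) (x (k + 1) - x k) ≥ ν * inner ℝ (∇ f (x k)) (x (k + 1) - x k)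

/-- The Hessian matrix of `f` at `x`: the Jacobian matrix of the gradient. -/
def hessian {n : ℕ} (f : EuclideanSpace ℝ (Fin n) → ℝ) (x : EuclideanSpace ℝ (Fin n)) :
    Matrix (Fin n) (Fin n) ℝ :=
  Matrix.of fun i j => (fderiv ℝ (∇ f) x (EuclideanSpace.single j 1)) i

/-- `f` is twice differentiable at every point of `V` and its Hessian is continuous and positive
definite throughout `V`. -/
def HasContinuousPosDefHessianOn {n : ℕ} (f : EuclideanSpace ℝ (Fin n) → ℝ)
    (V : Set (EuclideanSpace ℝ (Fin n))) : Prop :=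
  (∀ z ∈ V, DifferentiableAt ℝ f z ∧ DifferentiableAt ℝ (∇ f) z) ∧
  ContinuousOn (hessian f) V ∧
  ∀ z ∈ V, (hessian f z).PosDef

end

/-!
Let `Bₖ` be the inverse of the `k`-th BFGS matrix, `gₖ` the gradient at the `k`-th iterate, and
`sₖ`, `yₖ` the increments of iterate and gradient. The Byrd–Nocedal potential `tr B - log det B` is
nonnegative on positive definite matrices. The trace and determinant of a BFGS update are explicit,
and with the Wolfe condition they show that one step raises the potential by at most
`‖yₖ‖² / sₖᵀyₖ - log (‖gₖ‖² / (-gₖᵀsₖ))` plus a constant. The first term is bounded because the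
gradient map is Lipschitz and strongly monotone on the compact closure of the iterates. The Armijo
condition forces `gₖᵀsₖ → 0`, so gradients bounded away from zero would drive the potential to `-∞`.
Hence the gradient vanishes at some point of this closure, which by convexity is a minimizer, and
the monotone values of `f` along the iterates can only converge to the minimum.
-/

section MatrixUpdate

open Matrix

variable {ι : Type*} [Fintype ι]

theorem inner_eq_dotProduct (u v : EuclideanSpace ℝ ι) : inner ℝ u v = u.ofLp ⬝ᵥ v.ofLp := by
  rw [EuclideanSpace.inner_eq_star_dotProduct, star_trivial, dotProduct_comm]

theorem norm_sq_eq_dotProduct (v : EuclideanSpace ℝ ι) : ‖v‖ ^ 2 = v.ofLp ⬝ᵥ v.ofLp := by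
  rw [← real_inner_self_eq_norm_sq, inner_eq_dotProduct]

/-- The BFGS update of an approximate Hessian `B`, as opposed to an approximate inverse Hessian:
`B - B s sᵀ B / (sᵀ B s) + y yᵀ / (sᵀ y)`. For symmetric `B`, the factor `sᵀ B` is the transpose
of `B s`. -/
noncomputable def bfgsDirectUpdate (B : Matrix ι ι ℝ) (s y : ι → ℝ) : Matrix ι ι ℝ :=
  B - (s ⬝ᵥ B *ᵥ s)⁻¹ • vecMulVec (B *ᵥ s) (B *ᵥ s) + (s ⬝ᵥ y)⁻¹ • vecMulVec y y

theorem trace_bfgsDirectUpdate (B : Matrix ι ι ℝ) (s y : ι → ℝ) :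
    (bfgsDirectUpdate B s y).trace =
      B.trace - (B *ᵥ s ⬝ᵥ B *ᵥ s) / (s ⬝ᵥ B *ᵥ s) + (y ⬝ᵥ y) / (s ⬝ᵥ y) := by
  simp only [bfgsDirectUpdate, trace_add, trace_sub, trace_smul, trace_vecMulVec, smul_eq_mul,
    inv_mul_eq_div]

theorem vecMul_eq_mulVec_of_isHermitian {B : Matrix ι ι ℝ} (hB : B.IsHermitian) (v : ι → ℝ) :
    v ᵥ* B = B *ᵥ v := by
  rw [← mulVec_transpose, ← conjTranspose_eq_transpose_of_trivial, hB.eq]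

theorem vecMul_bfgsDirectUpdate {B : Matrix ι ι ℝ} (hB : B.IsHermitian) {s y : ι → ℝ}
    (hBs : s ⬝ᵥ B *ᵥ s ≠ 0) (hsy : s ⬝ᵥ y ≠ 0) : s ᵥ* bfgsDirectUpdate B s y = y := by
  rw [bfgsDirectUpdate, vecMul_add, vecMul_sub, vecMul_smul, vecMul_smul, vecMul_vecMulVec,
    vecMul_vecMulVec, vecMul_eq_mulVec_of_isHermitian hB, inv_smul_smul₀ hBs, inv_smul_smul₀ hsy,
    sub_self, zero_add]

theorem dotProduct_mulVec_pos_of_dotProduct_ne_zero {B : Matrix ι ι ℝ} (hB : B.PosDef)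
    {s y : ι → ℝ} (hsy : s ⬝ᵥ y ≠ 0) : 0 < s ⬝ᵥ B *ᵥ s := by
  have hs : s ≠ 0 := by
    rintro rfl
    exact hsy (zero_dotProduct y)
  simpa only [star_trivial] using hB.dotProduct_mulVec_pos hs

theorem det_one_add_vecMulVec [DecidableEq ι] (u v : ι → ℝ) :
    (1 + vecMulVec u v).det = 1 + v ⬝ᵥ u := by
  rw [vecMulVec_eq Unit, det_one_add_replicateCol_mul_replicateRow]

theorem one_add_vecMulVec_mul_mul_transpose [DecidableEq ι] {B : Matrix ι ι ℝ}
    (hB : B.IsHermitian) (u s : ι → ℝ) :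
    (1 + vecMulVec u s) * B * (1 + vecMulVec u s)ᵀ =
      B + vecMulVec u (B *ᵥ s) + vecMulVec (B *ᵥ s) u + (s ⬝ᵥ B *ᵥ s) • vecMulVec u u := by
  rw [transpose_add, transpose_one, transpose_vecMulVec, Matrix.add_mul, Matrix.one_mul,
    vecMulVec_mul, vecMul_eq_mulVec_of_isHermitian hB, Matrix.mul_add, Matrix.mul_one,
    Matrix.add_mul, mul_vecMulVec, vecMulVec_mul_vecMulVec, dotProduct_comm (B *ᵥ s),
    vecMulVec_smul, ← add_assoc]

-- The congruence factor is `1 + u sᵀ` with `u = y / √(sᵀ y ⬝ sᵀ B s) - B s / (sᵀ B s)`.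
theorem exists_bfgsDirectUpdate_eq_mul_mul_transpose [DecidableEq ι] {B : Matrix ι ι ℝ}
    (hB : B.IsHermitian) {s y : ι → ℝ} (hBs : 0 < s ⬝ᵥ B *ᵥ s) (hsy : 0 < s ⬝ᵥ y) :
    ∃ A : Matrix ι ι ℝ, A.det ^ 2 = (s ⬝ᵥ y) / (s ⬝ᵥ B *ᵥ s) ∧
      bfgsDirectUpdate B s y = A * B * Aᵀ := by
  set ρ := s ⬝ᵥ y with hρ
  set σ := s ⬝ᵥ B *ᵥ s with hσ
  obtain ⟨c, hc⟩ : ∃ c : ℝ, c ^ 2 = (ρ * σ)⁻¹ := ⟨√(ρ * σ)⁻¹, Real.sq_sqrt (by positivity)⟩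
  refine ⟨1 + vecMulVec (c • y - σ⁻¹ • B *ᵥ s) s, ?_, ?_⟩
  · have hdet : (1 + vecMulVec (c • y - σ⁻¹ • B *ᵥ s) s).det = c * ρ := by
      rw [det_one_add_vecMulVec, dotProduct_sub, dotProduct_smul, dotProduct_smul, ← hρ, ← hσ,
        smul_eq_mul, smul_eq_mul, inv_mul_cancel₀ hBs.ne', add_sub_cancel]
    rw [hdet, mul_pow, hc]
    field_simp
  · rw [one_add_vecMulVec_mul_mul_transpose hB, bfgsDirectUpdate, ← hρ, ← hσ]
    ext i j
    have hcc : σ * c ^ 2 = ρ⁻¹ := by rw [hc]; field_simp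
    simp only [Matrix.add_apply, Matrix.sub_apply, Matrix.smul_apply, vecMulVec_apply,
      Pi.sub_apply, Pi.smul_apply, smul_eq_mul, ← hcc]
    field_simp
    ring

theorem det_bfgsDirectUpdate [DecidableEq ι] {B : Matrix ι ι ℝ} (hB : B.IsHermitian)
    {s y : ι → ℝ} (hBs : 0 < s ⬝ᵥ B *ᵥ s) (hsy : 0 < s ⬝ᵥ y) :
    (bfgsDirectUpdate B s y).det = B.det * ((s ⬝ᵥ y) / (s ⬝ᵥ B *ᵥ s)) := by
  obtain ⟨A, hA, hBA⟩ := exists_bfgsDirectUpdate_eq_mul_mul_transpose hB hBs hsy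
  rw [hBA, det_mul, det_mul, det_transpose, ← hA]
  ring

theorem posDef_bfgsDirectUpdate {B : Matrix ι ι ℝ} (hB : B.PosDef) {s y : ι → ℝ}
    (hsy : 0 < s ⬝ᵥ y) : (bfgsDirectUpdate B s y).PosDef := by
  classical
  have hBs : 0 < s ⬝ᵥ B *ᵥ s := dotProduct_mulVec_pos_of_dotProduct_ne_zero hB hsy.ne'
  obtain ⟨A, hA, hBA⟩ := exists_bfgsDirectUpdate_eq_mul_mul_transpose hB.isHermitian hBs hsy
  have hAunit : IsUnit A := by
    rw [isUnit_iff_isUnit_det, isUnit_iff_ne_zero, ← sq_pos_iff, hA]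
    positivity
  rw [hBA, ← conjTranspose_eq_transpose_of_trivial]
  exact hAunit.posDef_star_right_conjugate_iff.2 hB

theorem bfgsUpdate_mul_bfgsDirectUpdate {n : ℕ} {H : Matrix (Fin n) (Fin n) ℝ} (hH : H.PosDef)
    {s y : EuclideanSpace ℝ (Fin n)} (hsy : s.ofLp ⬝ᵥ y.ofLp ≠ 0) :
    bfgsUpdate H s y * bfgsDirectUpdate H⁻¹ s.ofLp y.ofLp = 1 := by
  have hdet : IsUnit H.det := hH.det_pos.ne'.isUnit
  have hsBs : s.ofLp ⬝ᵥ H⁻¹ *ᵥ s.ofLp ≠ 0 :=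
    (dotProduct_mulVec_pos_of_dotProduct_ne_zero hH.inv hsy).ne'
  rw [bfgsUpdate, inner_eq_dotProduct]
  generalize s.ofLp = s at *
  generalize y.ofLp = y at *
  set ρ := s ⬝ᵥ y with hρ
  set σ := s ⬝ᵥ H⁻¹ *ᵥ s with hσ
  have secant : s ᵥ* bfgsDirectUpdate H⁻¹ s y = y :=
    vecMul_bfgsDirectUpdate hH.inv.isHermitian hsBs hsy
  have hW : (1 - ρ⁻¹ • vecMulVec s y)ᵀ * bfgsDirectUpdate H⁻¹ s y =
      H⁻¹ - σ⁻¹ • vecMulVec (H⁻¹ *ᵥ s) (H⁻¹ *ᵥ s) := by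
    rw [transpose_sub, transpose_one, transpose_smul, transpose_vecMulVec, Matrix.sub_mul,
      Matrix.one_mul, Matrix.smul_mul, vecMulVec_mul, secant, bfgsDirectUpdate, ← hρ, ← hσ,
      add_sub_cancel_right]
  have hHW : H * (H⁻¹ - σ⁻¹ • vecMulVec (H⁻¹ *ᵥ s) (H⁻¹ *ᵥ s)) =
      1 - σ⁻¹ • vecMulVec s (H⁻¹ *ᵥ s) := by
    rw [Matrix.mul_sub, mul_nonsing_inv H hdet, Matrix.mul_smul, mul_vecMulVec, mulVec_mulVec,
      mul_nonsing_inv H hdet, one_mulVec]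
  have hcancel : ρ⁻¹ • vecMulVec s y * (σ⁻¹ • vecMulVec s (H⁻¹ *ᵥ s)) =
      σ⁻¹ • vecMulVec s (H⁻¹ *ᵥ s) := by
    rw [Matrix.smul_mul, Matrix.mul_smul, vecMulVec_mul_vecMulVec, dotProduct_comm y s, ← hρ,
      vecMulVec_smul, smul_comm σ⁻¹ ρ, inv_smul_smul₀ hsy]
  rw [Matrix.add_mul, Matrix.mul_assoc, Matrix.mul_assoc, hW, hHW, Matrix.smul_mul, vecMulVec_mul,
    secant, Matrix.sub_mul, Matrix.one_mul, Matrix.mul_sub, Matrix.mul_one, hcancel]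
  abel

theorem inv_bfgsUpdate {n : ℕ} {H : Matrix (Fin n) (Fin n) ℝ} (hH : H.PosDef)
    {s y : EuclideanSpace ℝ (Fin n)} (hsy : s.ofLp ⬝ᵥ y.ofLp ≠ 0) :
    (bfgsUpdate H s y)⁻¹ = bfgsDirectUpdate H⁻¹ s.ofLp y.ofLp :=
  inv_eq_right_inv (bfgsUpdate_mul_bfgsDirectUpdate hH hsy)

theorem posDef_bfgsUpdate {n : ℕ} {H : Matrix (Fin n) (Fin n) ℝ} (hH : H.PosDef)
    {s y : EuclideanSpace ℝ (Fin n)} (hsy : 0 < s.ofLp ⬝ᵥ y.ofLp) :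
    (bfgsUpdate H s y).PosDef := by
  rw [← posDef_inv_iff, inv_bfgsUpdate hH hsy.ne']
  exact posDef_bfgsDirectUpdate hH.inv hsy

variable [DecidableEq ι]

theorem log_det_le_trace {B : Matrix ι ι ℝ} (hB : B.PosDef) : Real.log B.det ≤ B.trace := by
  have hdet : B.det = ∏ i, hB.isHermitian.eigenvalues i := hB.isHermitian.det_eq_prod_eigenvalues
  have htrace : B.trace = ∑ i, hB.isHermitian.eigenvalues i :=
    hB.isHermitian.trace_eq_sum_eigenvalues
  rw [hdet, htrace, Real.log_prod fun i _ => (hB.eigenvalues_pos i).ne']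
  exact Finset.sum_le_sum fun i _ => Real.log_le_self (hB.eigenvalues_pos i).le

/-- The Byrd–Nocedal potential `tr B - log det B`, a nonnegative measure of how far the positive
definite matrix `B` is from being well conditioned. -/
noncomputable def byrdNocedalPotential (B : Matrix ι ι ℝ) : ℝ :=
  B.trace - Real.log B.det

theorem byrdNocedalPotential_nonneg {B : Matrix ι ι ℝ} (hB : B.PosDef) :
    0 ≤ byrdNocedalPotential B :=
  sub_nonneg.2 (log_det_le_trace hB)

theorem byrdNocedalPotential_bfgsDirectUpdate_le {B : Matrix ι ι ℝ} (hB : B.PosDef)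
    {s y : ι → ℝ} (hsy : 0 < s ⬝ᵥ y) :
    byrdNocedalPotential (bfgsDirectUpdate B s y) ≤
      byrdNocedalPotential B + (y ⬝ᵥ y) / (s ⬝ᵥ y) - 1 -
        Real.log ((s ⬝ᵥ y) * (B *ᵥ s ⬝ᵥ B *ᵥ s) / (s ⬝ᵥ B *ᵥ s) ^ 2) := by
  have hσ : 0 < s ⬝ᵥ B *ᵥ s := dotProduct_mulVec_pos_of_dotProduct_ne_zero hB hsy.ne'
  have hβ : 0 < B *ᵥ s ⬝ᵥ B *ᵥ s := by
    refine lt_of_le_of_ne (dotProduct_self_star_nonneg (B *ᵥ s)) fun h => ?_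
    rw [dotProduct_self_eq_zero.1 h.symm, dotProduct_zero] at hσ
    exact hσ.false
  rw [byrdNocedalPotential, byrdNocedalPotential, trace_bfgsDirectUpdate,
    det_bfgsDirectUpdate hB.isHermitian hσ hsy,
    Real.log_mul hB.det_pos.ne' (div_pos hsy hσ).ne', sq, mul_div_mul_comm,
    Real.log_mul (div_pos hsy hσ).ne' (div_pos hβ hσ).ne']
  linarith [Real.log_le_sub_one_of_pos (div_pos hβ hσ)]

end MatrixUpdate

section StronglyMonotone

variable {E : Type*} [NormedAddCommGroup E] [InnerProductSpace ℝ E]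

/-- The map `F` is strongly monotone on `S` with modulus `m`. It is merely monotone on `S` when
`m = 0`. -/
def StronglyMonotoneOn (m : ℝ) (F : E → E) (S : Set E) : Prop :=
  ∀ p ∈ S, ∀ q ∈ S, m * ‖q - p‖ ^ 2 ≤ inner ℝ (q - p) (F q - F p)

theorem stronglyMonotoneOn_of_fderiv {F : E → E} {C : Set E} {m : ℝ} (hC : Convex ℝ C)
    (hF : ∀ z ∈ C, DifferentiableAt ℝ F z)
    (hm : ∀ z ∈ C, ∀ v, m * ‖v‖ ^ 2 ≤ inner ℝ v (fderiv ℝ F z v)) :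
    StronglyMonotoneOn m F C := by
  intro p hp q hq
  obtain ⟨z, hz, hmvt⟩ := domain_mvt
    (fun z hz => ((innerSL ℝ (q - p)).hasFDerivAt.comp z (hF z hz).hasFDerivAt).hasFDerivWithinAt)
    hC hp hq
  have hmvt' : inner ℝ (q - p) (F q - F p) = inner ℝ (q - p) (fderiv ℝ F z (q - p)) := by
    rw [inner_sub_right]
    exact hmvt
  exact (hm z (hC.segment_subset hp hq hz) (q - p)).trans_eq hmvt'.symm

theorem mul_sq_le_inner_of_lineMap {F : E → E} {p q : E} {m τ : ℝ} (hτ₀ : 0 < τ) (hτ₁ : τ < 1)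
    (hp : m * ‖AffineMap.lineMap p q τ - p‖ ^ 2 ≤
      inner ℝ (AffineMap.lineMap p q τ - p) (F (AffineMap.lineMap p q τ) - F p))
    (hq : 0 ≤ inner ℝ (q - AffineMap.lineMap p q τ) (F q - F (AffineMap.lineMap p q τ))) :
    m * τ * ‖q - p‖ ^ 2 ≤ inner ℝ (q - p) (F q - F p) := by
  set r : E := AffineMap.lineMap p q τ with hr
  have hrp : r - p = τ • (q - p) := by rw [hr, AffineMap.lineMap_apply_module']; abel
  have hqr : q - r = (1 - τ) • (q - p) := by
    rw [hr, AffineMap.lineMap_apply_module', sub_smul, one_smul]; abel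
  rw [hrp, norm_smul, mul_pow, Real.norm_of_nonneg hτ₀.le, real_inner_smul_left] at hp
  rw [hqr, real_inner_smul_left] at hq
  have hnear : m * τ * ‖q - p‖ ^ 2 ≤ inner ℝ (q - p) (F r - F p) :=
    le_of_mul_le_mul_left (by linarith) hτ₀
  have hfar : 0 ≤ inner ℝ (q - p) (F q - F r) := nonneg_of_mul_nonneg_right hq (sub_pos.2 hτ₁)
  calc m * τ * ‖q - p‖ ^ 2 ≤ inner ℝ (q - p) (F q - F r) + inner ℝ (q - p) (F r - F p) := by
        linarith
    _ = inner ℝ (q - p) (F q - F p) := by rw [← inner_add_right, sub_add_sub_cancel]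

theorem StronglyMonotoneOn.cocoercive {F : E → E} {S : Set E} {m : ℝ} {L : NNReal}
    (hF : StronglyMonotoneOn m F S) (hm : 0 < m) (hL : LipschitzOnWith L F S) {p q : E}
    (hp : p ∈ S) (hq : q ∈ S) :
    ‖F q - F p‖ ^ 2 ≤ L ^ 2 / m * inner ℝ (q - p) (F q - F p) :=
  calc ‖F q - F p‖ ^ 2 ≤ (L * ‖q - p‖) ^ 2 := by
        gcongr
        exact hL.norm_sub_le hq hp
    _ = L ^ 2 / m * (m * ‖q - p‖ ^ 2) := by field_simp
    _ ≤ L ^ 2 / m * inner ℝ (q - p) (F q - F p) := by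
        gcongr
        exact hF p hp q hq

theorem exists_lipschitzOnWith_of_isCompact {G G' : Type*} [NormedAddCommGroup G] [NormedSpace ℝ G]
    [NormedAddCommGroup G'] [NormedSpace ℝ G'] {F : G → G'} {V K : Set G} (hV : IsOpen V)
    (hF : ContDiffOn ℝ 1 F V) (hK : IsCompact K) (hKV : K ⊆ V) :
    ∃ L, LipschitzOnWith L F K := by
  refine LocallyLipschitzOn.exists_lipschitzOnWith_of_compact hK fun z hz => ?_
  obtain ⟨L, t, ht, hL⟩ :=
    (hF.contDiffAt (hV.mem_nhds (hKV hz))).exists_lipschitzOnWith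
  exact ⟨L, t, mem_nhdsWithin_of_mem_nhds ht, hL⟩

theorem exists_forall_mul_sq_le_inner [FiniteDimensional ℝ E] {X : Type*} [TopologicalSpace X]
    {A : X → E →L[ℝ] E} {K : Set X} (hK : IsCompact K) (hA : ContinuousOn A K)
    (hpos : ∀ z ∈ K, ∀ v ≠ 0, 0 < inner ℝ v (A z v)) :
    ∃ m > 0, ∀ z ∈ K, ∀ v, m * ‖v‖ ^ 2 ≤ inner ℝ v (A z v) := by
  have := FiniteDimensional.proper ℝ E
  have hcont : ContinuousOn (fun w : X × E => inner ℝ w.2 (A w.1 w.2))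
      (K ×ˢ Metric.sphere 0 1) :=
    continuousOn_snd.inner
      ((hA.comp continuousOn_fst fun _ hw => hw.1).clm_apply continuousOn_snd)
  obtain ⟨m, hm, hsphere⟩ :=
    (hK.prod (isCompact_sphere (0 : E) 1)).exists_forall_le' hcont (a := 0)
      fun w hw => hpos w.1 hw.1 w.2 (ne_zero_of_mem_unit_sphere ⟨w.2, hw.2⟩)
  refine ⟨m, hm, fun z hz v => ?_⟩
  rcases eq_or_ne v 0 with rfl | hv
  · simp
  have hvn : 0 < ‖v‖ := norm_pos_iff.2 hv
  have hunit : m ≤ ‖v‖⁻¹ * (‖v‖⁻¹ * inner ℝ v (A z v)) := by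
    simpa only [map_smul, real_inner_smul_left, real_inner_smul_right] using
      hsphere (z, ‖v‖⁻¹ • v) ⟨hz, by simp [norm_smul, hvn.ne']⟩
  calc m * ‖v‖ ^ 2 ≤ ‖v‖⁻¹ * (‖v‖⁻¹ * inner ℝ v (A z v)) * ‖v‖ ^ 2 := by gcongr
    _ = inner ℝ v (A z v) := by field_simp

-- Segments between points of `K` may leave `V`, so positivity of the derivative is used only on an
-- initial portion of each segment; plain monotonicity takes care of the rest.
theorem exists_stronglyMonotoneOn_of_isCompact [FiniteDimensional ℝ E] {F : E → E} {V K : Set E}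
    (hV : IsOpen V) (hF : ContDiffOn ℝ 1 F V)
    (hpos : ∀ z ∈ V, ∀ v ≠ 0, 0 < inner ℝ v (fderiv ℝ F z v))
    (hmono : StronglyMonotoneOn 0 F V) (hK : IsCompact K) (hKV : K ⊆ V) :
    ∃ m > 0, StronglyMonotoneOn m F K := by
  have := FiniteDimensional.proper ℝ E
  obtain ⟨δ, hδ, hδV⟩ := hK.exists_cthickening_subset_open hV hKV
  obtain ⟨m, hm, hcoercive⟩ := exists_forall_mul_sq_le_inner hK.cthickening
    ((hF.continuousOn_fderiv_of_isOpen hV le_rfl).mono hδV) fun z hz => hpos z (hδV hz)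
  have hball : ∀ p ∈ K, StronglyMonotoneOn m F (Metric.closedBall p δ) := fun p hp =>
    have hsub := Metric.closedBall_subset_cthickening hp δ
    stronglyMonotoneOn_of_fderiv (convex_closedBall p δ)
      (fun z hz => (hF.contDiffAt (hV.mem_nhds (hδV (hsub hz)))).differentiableAt one_ne_zero)
      fun z hz => hcoercive z (hsub hz)
  obtain ⟨R, hR, hdist⟩ : ∃ R, δ < R ∧ ∀ p ∈ K, ∀ q ∈ K, dist p q ≤ R :=
    ⟨max (Metric.diam K) (δ + 1), by simp, fun p hp q hq =>
      (Metric.dist_le_diam_of_mem hK.isBounded hp hq).trans (le_max_left _ _)⟩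
  have hR₀ : 0 < R := hδ.trans hR
  refine ⟨m * (δ / R), by positivity, fun p hp q hq => ?_⟩
  have hr : AffineMap.lineMap p q (δ / R) ∈ Metric.closedBall p δ := by
    rw [Metric.mem_closedBall, dist_lineMap_left, Real.norm_of_nonneg (by positivity)]
    calc δ / R * dist p q ≤ δ / R * R := by
          gcongr
          exact hdist p hp q hq
      _ = δ := div_mul_cancel₀ δ hR₀.ne'
  have hrV := hδV (Metric.closedBall_subset_cthickening hp δ hr)
  refine mul_sq_le_inner_of_lineMap (by positivity) ((div_lt_one hR₀).2 hR)
    (hball p hp p (Metric.mem_closedBall_self hδ.le) _ hr) ?_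
  simpa only [zero_mul] using hmono _ hrV q (hKV hq)

end StronglyMonotone

section ConvexGradient

variable {E : Type*} [NormedAddCommGroup E] [InnerProductSpace ℝ E] [CompleteSpace E]
  {U : Set E} {f : E → ℝ}

theorem add_inner_gradient_le_of_convexOn (hf : ConvexOn ℝ U f) {p q : E} (hp : p ∈ U)
    (hq : q ∈ U) (hd : DifferentiableAt ℝ f p) : f p + inner ℝ (∇ f p) (q - p) ≤ f q := by
  have hconv := hf.comp_affineMap (AffineMap.lineMap p q : ℝ →ᵃ[ℝ] E)
  have hderiv : HasDerivAt (f ∘ AffineMap.lineMap p q) (fderiv ℝ f p (q - p)) (0 : ℝ) := by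
    refine HasFDerivAt.comp_hasDerivAt _ ?_ AffineMap.hasDerivAt_lineMap
    simpa only [AffineMap.lineMap_apply_zero] using hd.hasFDerivAt
  have hslope := hconv.le_slope_of_hasDerivAt (x := 0) (y := 1) (by simpa using hp)
    (by simpa using hq) one_pos hderiv
  simp only [slope_def_field, Function.comp_apply, AffineMap.lineMap_apply_one,
    AffineMap.lineMap_apply_zero, sub_zero, div_one] at hslope
  rw [inner_gradient_left]
  linarith

theorem stronglyMonotoneOn_zero_gradient (hf : ConvexOn ℝ U f) {V : Set E} (hVU : V ⊆ U)
    (hd : ∀ z ∈ V, DifferentiableAt ℝ f z) : StronglyMonotoneOn 0 (∇ f) V := by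
  intro p hp q hq
  have hpq := add_inner_gradient_le_of_convexOn hf (hVU hp) (hVU hq) (hd p hp)
  have hqp := add_inner_gradient_le_of_convexOn hf (hVU hq) (hVU hp) (hd q hq)
  rw [← neg_sub q p, inner_neg_right] at hqp
  rw [zero_mul, real_inner_comm, inner_sub_left]
  linarith

theorem isMinOn_of_gradient_eq_zero (hf : ConvexOn ℝ U f) {z : E} (hz : z ∈ U)
    (hd : DifferentiableAt ℝ f z) (hgrad : ∇ f z = 0) : IsMinOn f U z :=
  isMinOn_iff.2 fun q hq => by
    simpa only [hgrad, inner_zero_left, add_zero] using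
      add_inner_gradient_le_of_convexOn hf hz hq hd

end ConvexGradient

section Hessian

variable {n : ℕ} {f : EuclideanSpace ℝ (Fin n) → ℝ} {U V K : Set (EuclideanSpace ℝ (Fin n))}

theorem toEuclideanCLM_hessian (f : EuclideanSpace ℝ (Fin n) → ℝ)
    (z : EuclideanSpace ℝ (Fin n)) :
    Matrix.toEuclideanCLM (𝕜 := ℝ) (hessian f z) = fderiv ℝ (∇ f) z := by
  refine ContinuousLinearMap.coe_injective
    ((EuclideanSpace.basisFun (Fin n) ℝ).toBasis.ext fun j => ?_)
  ext i
  simp [hessian]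

namespace HasContinuousPosDefHessianOn

theorem inner_fderiv_gradient_pos (hess : HasContinuousPosDefHessianOn f V)
    {z v : EuclideanSpace ℝ (Fin n)} (hz : z ∈ V) (hv : v ≠ 0) :
    0 < inner ℝ v (fderiv ℝ (∇ f) z v) := by
  rw [← toEuclideanCLM_hessian, Matrix.inner_toEuclideanCLM]
  exact (hess.2.2 z hz).dotProduct_mulVec_pos ((WithLp.ofLp_eq_zero 2).not.2 hv)

theorem contDiffOn_gradient (hess : HasContinuousPosDefHessianOn f V) (hV : IsOpen V) :
    ContDiffOn ℝ 1 (∇ f) V := by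
  let T : Matrix (Fin n) (Fin n) ℝ →ₗ[ℝ] _ :=
    (Matrix.toEuclideanCLM (n := Fin n) (𝕜 := ℝ)).toAlgEquiv.toLinearMap
  have hfderiv : ContinuousOn (fderiv ℝ (∇ f)) V :=
    (T.continuous_of_finiteDimensional.comp_continuousOn hess.2.1).congr fun z _ =>
      (toEuclideanCLM_hessian f z).symm
  rw [← zero_add (1 : WithTop ℕ∞), contDiffOn_succ_iff_fderiv_of_isOpen hV, contDiffOn_zero]
  exact ⟨fun z hz => (hess.1 z hz).2.differentiableWithinAt, by simp, hfderiv⟩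

theorem exists_cocoercive (hess : HasContinuousPosDefHessianOn f V) (hf : ConvexOn ℝ U f)
    (hV : IsOpen V) (hVU : V ⊆ U) (hK : IsCompact K) (hKV : K ⊆ V) :
    ∃ M, ∀ p ∈ K, ∀ q ∈ K, ‖∇ f q - ∇ f p‖ ^ 2 ≤ M * inner ℝ (q - p) (∇ f q - ∇ f p) := by
  have hC1 : ContDiffOn ℝ 1 (∇ f) V := hess.contDiffOn_gradient hV
  obtain ⟨L, hL⟩ := exists_lipschitzOnWith_of_isCompact hV hC1 hK hKV
  obtain ⟨m, hm, hstrong⟩ := exists_stronglyMonotoneOn_of_isCompact hV hC1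
    (fun z hz v hv => hess.inner_fderiv_gradient_pos hz hv)
    (stronglyMonotoneOn_zero_gradient hf hVU fun z hz => (hess.1 z hz).1) hK hKV
  exact ⟨L ^ 2 / m, fun p hp q hq => hstrong.cocoercive hm hL hp hq⟩

end HasContinuousPosDefHessianOn

end Hessian

section BFGSStep

open Matrix

variable {n : ℕ} {ν : ℝ} {H : Matrix (Fin n) (Fin n) ℝ} {g s y : EuclideanSpace ℝ (Fin n)}

/-- One step `s` of the BFGS method, taken from a point with gradient `g` and approximate inverse
Hessian `H`, along which the gradient changes by `y`. The weak Wolfe condition with parameter `ν`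
is recorded as a lower bound on the curvature `sᵀ y`. -/
structure IsBFGSStep (ν : ℝ) (H : Matrix (Fin n) (Fin n) ℝ)
    (g s y : EuclideanSpace ℝ (Fin n)) : Prop where
  posDef : H.PosDef
  gradient_ne_zero : g ≠ 0
  lt_one : ν < 1
  exists_mulVec_eq : ∃ t : ℝ, 0 ≤ t ∧ H *ᵥ g.ofLp = -(t • s.ofLp)
  curvature : (1 - ν) * -inner ℝ g s ≤ inner ℝ s y

namespace IsBFGSStep

theorem exists_inv_mulVec_eq (h : IsBFGSStep ν H g s y) :
    ∃ τ : ℝ, 0 < τ ∧ H⁻¹ *ᵥ s.ofLp = -(τ • g.ofLp) := by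
  obtain ⟨t, ht, hHg⟩ := h.exists_mulVec_eq
  have hg : H⁻¹ *ᵥ (H *ᵥ g.ofLp) = g.ofLp := by
    rw [mulVec_mulVec, nonsing_inv_mul _ h.posDef.det_pos.ne'.isUnit, one_mulVec]
  have ht₀ : t ≠ 0 := by
    rintro rfl
    rw [hHg, zero_smul, neg_zero, mulVec_zero] at hg
    exact h.gradient_ne_zero ((WithLp.ofLp_eq_zero 2).1 hg.symm)
  refine ⟨t⁻¹, inv_pos.2 (ht.lt_of_ne' ht₀), ?_⟩
  rw [← hg, hHg, mulVec_neg, mulVec_smul, smul_neg, inv_smul_smul₀ ht₀, neg_neg]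

theorem step_ne_zero (h : IsBFGSStep ν H g s y) : s.ofLp ≠ 0 := by
  obtain ⟨τ, hτ, hBs⟩ := h.exists_inv_mulVec_eq
  intro hs
  rw [hs, mulVec_zero, zero_eq_neg, smul_eq_zero_iff_right hτ.ne', WithLp.ofLp_eq_zero] at hBs
  exact h.gradient_ne_zero hBs

theorem inner_gradient_neg (h : IsBFGSStep ν H g s y) : inner ℝ g s < 0 := by
  obtain ⟨τ, hτ, hBs⟩ := h.exists_inv_mulVec_eq
  have hpos : 0 < s.ofLp ⬝ᵥ H⁻¹ *ᵥ s.ofLp := by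
    simpa only [star_trivial] using h.posDef.inv.dotProduct_mulVec_pos h.step_ne_zero
  rw [hBs, dotProduct_neg, dotProduct_smul, smul_eq_mul, neg_pos, dotProduct_comm] at hpos
  rw [inner_eq_dotProduct]
  exact neg_of_mul_neg_right hpos hτ.le

theorem inner_pos (h : IsBFGSStep ν H g s y) : 0 < inner ℝ s y :=
  (mul_pos (sub_pos.2 h.lt_one) (neg_pos.2 h.inner_gradient_neg)).trans_le h.curvature

theorem posDef_bfgsUpdate (h : IsBFGSStep ν H g s y) : (bfgsUpdate H s y).PosDef :=
  _root_.posDef_bfgsUpdate h.posDef (inner_eq_dotProduct s y ▸ h.inner_pos)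

theorem one_sub_mul_sq_norm_div_le (h : IsBFGSStep ν H g s y) :
    (1 - ν) * (‖g‖ ^ 2 / -inner ℝ g s) ≤
      inner ℝ s y * (H⁻¹ *ᵥ s.ofLp ⬝ᵥ H⁻¹ *ᵥ s.ofLp) / (s.ofLp ⬝ᵥ H⁻¹ *ᵥ s.ofLp) ^ 2 := by
  obtain ⟨τ, hτ, hBs⟩ := h.exists_inv_mulVec_eq
  have hp : 0 < -inner ℝ g s := neg_pos.2 h.inner_gradient_neg
  have hnum : H⁻¹ *ᵥ s.ofLp ⬝ᵥ H⁻¹ *ᵥ s.ofLp = τ ^ 2 * ‖g‖ ^ 2 := by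
    rw [hBs, neg_dotProduct_neg, smul_dotProduct, dotProduct_smul, ← norm_sq_eq_dotProduct,
      smul_eq_mul, smul_eq_mul, sq τ, mul_assoc]
  have hden : s.ofLp ⬝ᵥ H⁻¹ *ᵥ s.ofLp = τ * -inner ℝ g s := by
    rw [hBs, dotProduct_neg, dotProduct_smul, dotProduct_comm, ← inner_eq_dotProduct, smul_eq_mul,
      mul_neg]
  rw [hnum, hden]
  calc (1 - ν) * (‖g‖ ^ 2 / -inner ℝ g s)
      = (1 - ν) * -inner ℝ g s * (τ ^ 2 * ‖g‖ ^ 2) / (τ * -inner ℝ g s) ^ 2 := by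
        generalize -inner ℝ g s = p at *
        field_simp
    _ ≤ inner ℝ s y * (τ ^ 2 * ‖g‖ ^ 2) / (τ * -inner ℝ g s) ^ 2 := by
        gcongr
        exact h.curvature

theorem byrdNocedalPotential_le (h : IsBFGSStep ν H g s y) {M : ℝ}
    (hM : ‖y‖ ^ 2 ≤ M * inner ℝ s y) :
    byrdNocedalPotential (bfgsUpdate H s y)⁻¹ ≤
      byrdNocedalPotential H⁻¹ + (M - 1 - Real.log (1 - ν)) -
        Real.log (‖g‖ ^ 2 / -inner ℝ g s) := by
  have hsy : 0 < s.ofLp ⬝ᵥ y.ofLp := inner_eq_dotProduct s y ▸ h.inner_pos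
  have hν : 0 < 1 - ν := sub_pos.2 h.lt_one
  have hquot : 0 < ‖g‖ ^ 2 / -inner ℝ g s :=
    div_pos (pow_pos (norm_pos_iff.2 h.gradient_ne_zero) 2) (neg_pos.2 h.inner_gradient_neg)
  have hlog := Real.log_le_log (mul_pos hν hquot) h.one_sub_mul_sq_norm_div_le
  rw [Real.log_mul hν.ne' hquot.ne', inner_eq_dotProduct s y] at hlog
  have htrace : (y.ofLp ⬝ᵥ y.ofLp) / (s.ofLp ⬝ᵥ y.ofLp) ≤ M := by
    rwa [← norm_sq_eq_dotProduct, ← inner_eq_dotProduct, div_le_iff₀ h.inner_pos]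
  have hupdate := byrdNocedalPotential_bfgsDirectUpdate_le h.posDef.inv hsy
  rw [inv_bfgsUpdate h.posDef hsy.ne']
  linarith

end IsBFGSStep

end BFGSStep

section RealSequences

theorem frequently_sub_lt_succ {ψ : ℕ → ℝ} (hψ : BddBelow (Set.range ψ)) {c : ℝ} (hc : 0 < c) :
    ∃ᶠ k in atTop, ψ k - c < ψ (k + 1) := by
  intro hdrop
  obtain ⟨N, hN⟩ := eventually_atTop.1 hdrop
  have hlin : ∀ j : ℕ, ψ (N + j) ≤ ψ N - j * c := by
    intro j
    induction j with
    | zero => simp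
    | succ j ih =>
      rw [← add_assoc]
      push_cast
      linarith [not_lt.1 (hN (N + j) (Nat.le_add_right N j))]
  obtain ⟨b, hb⟩ := hψ
  obtain ⟨j, hj⟩ := exists_nat_gt ((ψ N - b) / c)
  rw [div_lt_iff₀ hc] at hj
  linarith [hlin j, hb (Set.mem_range_self (N + j))]

theorem frequently_lt_of_le_add_sub_log_div {ψ a p : ℕ → ℝ} {C ε : ℝ}
    (hψ : BddBelow (Set.range ψ)) (ha : ∀ k, 0 < a k) (hp : ∀ k, 0 < p k)
    (hp₀ : Tendsto p atTop (𝓝 0)) (hstep : ∀ k, ψ (k + 1) ≤ ψ k + C - Real.log (a k / p k))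
    (hε : 0 < ε) : ∃ᶠ k in atTop, a k < ε := by
  have hsmall : ∀ᶠ k in atTop, p k < ε / Real.exp (C + 1) :=
    hp₀.eventually_lt_const (by positivity)
  refine ((frequently_sub_lt_succ hψ one_pos).and_eventually hsmall).mono ?_
  rintro k ⟨hdrop, hpk⟩
  have hratio : a k / p k < Real.exp (C + 1) :=
    (Real.log_lt_iff_lt_exp (div_pos (ha k) (hp k))).1 (by linarith [hstep k])
  calc a k < Real.exp (C + 1) * p k := (div_lt_iff₀ (hp k)).1 hratio
    _ < ε := by rwa [mul_comm, ← lt_div_iff₀ (Real.exp_pos _)]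

theorem tendsto_sub_succ_of_antitone {u : ℕ → ℝ} (hu : Antitone u) (hb : BddBelow (Set.range u)) :
    Tendsto (fun k => u k - u (k + 1)) atTop (𝓝 0) := by
  have hlim := tendsto_atTop_ciInf hu hb
  simpa only [sub_self, Function.comp_apply] using hlim.sub (hlim.comp (tendsto_add_atTop_nat 1))

end RealSequences

section ClusterPoints

variable {X : Type*} [TopologicalSpace X]

theorem tendsto_of_antitone_of_mem_closure_range {f : X → ℝ} {x : ℕ → X} {z : X}
    (hf : ContinuousAt f z) (hz : z ∈ closure (Set.range x)) (hanti : Antitone (f ∘ x))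
    (hmin : ∀ k, f z ≤ f (x k)) : Tendsto (f ∘ x) atTop (𝓝 (f z)) := by
  refine tendsto_atTop_isGLB hanti (isGLB_of_mem_closure (Set.forall_mem_range.2 hmin) ?_)
  rw [Set.range_comp]
  exact mem_closure_image hf hz

theorem exists_mem_closure_range_eq_zero {E : Type*} [NormedAddCommGroup E] {F : X → E}
    {x : ℕ → X} (hx : IsCompact (closure (Set.range x)))
    (hF : ContinuousOn F (closure (Set.range x))) (hsmall : ∀ ε > 0, ∃ k, ‖F (x k)‖ < ε) :
    ∃ z ∈ closure (Set.range x), F z = 0 := by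
  obtain ⟨z, hz, hmin⟩ :=
    hx.exists_isMinOn ⟨x 0, subset_closure (Set.mem_range_self 0)⟩ hF.norm
  refine ⟨z, hz, by_contra fun hne => ?_⟩
  obtain ⟨k, hk⟩ := hsmall ‖F z‖ (norm_pos_iff.2 hne)
  exact hk.not_ge (hmin (subset_closure (Set.mem_range_self k)))

end ClusterPoints

section BFGSSequence

variable {n : ℕ} {f : EuclideanSpace ℝ (Fin n) → ℝ} {x : ℕ → EuclideanSpace ℝ (Fin n)}

namespace IsBFGSSequence

theorem exists_isBFGSStep (hx : IsBFGSSequence f x) :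
    ∃ μ > 0, ∃ ν H₀, ∀ k,
      IsBFGSStep ν (bfgsMatrix f x H₀ k) (∇ f (x k)) (x (k + 1) - x k)
          (∇ f (x (k + 1)) - ∇ f (x k)) ∧
        f (x (k + 1)) ≤ f (x k) + μ * inner ℝ (∇ f (x k)) (x (k + 1) - x k) := by
  obtain ⟨hgrad, μ, ν, H₀, hμ, -, hν, hH₀, hstep⟩ := hx
  have hbfgs : ∀ k, (bfgsMatrix f x H₀ k).PosDef →
      IsBFGSStep ν (bfgsMatrix f x H₀ k) (∇ f (x k)) (x (k + 1) - x k)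
        (∇ f (x (k + 1)) - ∇ f (x k)) := fun k hk =>
    { posDef := hk
      gradient_ne_zero := (hgrad k).2
      lt_one := hν
      exists_mulVec_eq := (hstep k).1
      curvature := by
        rw [real_inner_comm (∇ f (x (k + 1)) - ∇ f (x k)), inner_sub_left]
        linarith [(hstep k).2.2] }
  have hposDef : ∀ k, (bfgsMatrix f x H₀ k).PosDef := fun k => by
    induction k with
    | zero => exact hH₀
    | succ k ih => exact (hbfgs k ih).posDef_bfgsUpdate
  exact ⟨μ, hμ, ν, H₀, fun k => ⟨hbfgs k (hposDef k), (hstep k).2.1⟩⟩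

theorem antitone (hx : IsBFGSSequence f x) : Antitone (f ∘ x) := by
  obtain ⟨μ, hμ, ν, H₀, hstep⟩ := hx.exists_isBFGSStep
  refine antitone_nat_of_succ_le fun k => (hstep k).2.trans ?_
  exact add_le_of_nonpos_right
    (mul_nonpos_of_nonneg_of_nonpos hμ.le (hstep k).1.inner_gradient_neg.le)

theorem tendsto_neg_inner_gradient (hx : IsBFGSSequence f x)
    (hb : BddBelow (Set.range (f ∘ x))) :
    Tendsto (fun k => -inner ℝ (∇ f (x k)) (x (k + 1) - x k)) atTop (𝓝 0) := by
  obtain ⟨μ, hμ, ν, H₀, hstep⟩ := hx.exists_isBFGSStep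
  have hdecrease : Tendsto (fun k => (f (x k) - f (x (k + 1))) / μ) atTop (𝓝 0) := by
    simpa only [zero_div, Function.comp_apply] using
      (tendsto_sub_succ_of_antitone hx.antitone hb).div_const μ
  refine squeeze_zero (fun k => (neg_pos.2 (hstep k).1.inner_gradient_neg).le) (fun k => ?_)
    hdecrease
  rw [le_div_iff₀ hμ]
  linarith [(hstep k).2]

theorem frequently_norm_gradient_lt (hx : IsBFGSSequence f x)
    (hb : BddBelow (Set.range (f ∘ x))) {M : ℝ}
    (hM : ∀ k, ‖∇ f (x (k + 1)) - ∇ f (x k)‖ ^ 2 ≤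
      M * inner ℝ (x (k + 1) - x k) (∇ f (x (k + 1)) - ∇ f (x k)))
    {ε : ℝ} (hε : 0 < ε) : ∃ᶠ k in atTop, ‖∇ f (x k)‖ < ε := by
  obtain ⟨μ, -, ν, H₀, hstep⟩ := hx.exists_isBFGSStep
  have hψ : BddBelow (Set.range fun k => byrdNocedalPotential (bfgsMatrix f x H₀ k)⁻¹) :=
    ⟨0, Set.forall_mem_range.2 fun k => byrdNocedalPotential_nonneg (hstep k).1.posDef.inv⟩
  refine (frequently_lt_of_le_add_sub_log_div hψ
    (fun k => pow_pos (norm_pos_iff.2 (hstep k).1.gradient_ne_zero) 2)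
    (fun k => neg_pos.2 (hstep k).1.inner_gradient_neg) (hx.tendsto_neg_inner_gradient hb)
    (fun k => (hstep k).1.byrdNocedalPotential_le (hM k)) (pow_pos hε 2)).mono fun k hk => ?_
  exact lt_of_pow_lt_pow_left₀ 2 hε.le hk

end IsBFGSSequence

end BFGSSequence

theorem theorem2_general {n : ℕ} {U V : Set (EuclideanSpace ℝ (Fin n))}
    {f : EuclideanSpace ℝ (Fin n) → ℝ} {x : ℕ → EuclideanSpace ℝ (Fin n)}
    (hf : ConvexOn ℝ U f) (hx : IsBFGSSequence f x) (hb : Bornology.IsBounded (Set.range x))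
    (hVo : IsOpen V) (hVU : V ⊆ U) (hxV : closure (Set.range x) ⊆ V)
    (hess : HasContinuousPosDefHessianOn f V) :
    ∃ xmin ∈ U, IsMinOn f U xmin ∧ Tendsto (fun k => f (x k)) atTop (𝓝 (f xmin)) := by
  have hK : IsCompact (closure (Set.range x)) := hb.isCompact_closure
  have hxK : ∀ k, x k ∈ closure (Set.range x) := fun k => subset_closure (Set.mem_range_self k)
  have hfc : ∀ z ∈ V, ContinuousAt f z := fun z hz => (hess.1 z hz).1.continuousAt
  have hbdd : BddBelow (Set.range (f ∘ x)) :=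
    (hK.bddBelow_image (continuousOn_of_forall_continuousAt fun z hz => hfc z (hxV hz))).mono
      (Set.range_subset_iff.2 fun k => Set.mem_image_of_mem f (hxK k))
  obtain ⟨M, hM⟩ := hess.exists_cocoercive hf hVo hVU hK hxV
  obtain ⟨z, hzK, hz⟩ := exists_mem_closure_range_eq_zero hK
    ((hess.contDiffOn_gradient hVo).continuousOn.mono hxV) fun ε hε =>
      (hx.frequently_norm_gradient_lt hbdd (fun k => hM _ (hxK k) _ (hxK (k + 1))) hε).exists
  have hmin : IsMinOn f U z :=
    isMinOn_of_gradient_eq_zero hf (hVU (hxV hzK)) (hess.1 z (hxV hzK)).1 hz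
  exact ⟨z, hVU (hxV hzK), hmin, tendsto_of_antitone_of_mem_closure_range (hfc z (hxV hzK)) hzK
    hx.antitone fun k => hmin (hVU (hxV (hxK k)))⟩

theorem theorem2 {n : ℕ} (U V : Set (EuclideanSpace ℝ (Fin n)))
    (f : EuclideanSpace ℝ (Fin n) → ℝ) (x : ℕ → EuclideanSpace ℝ (Fin n))
    (hUo : IsOpen U) (hUc : Convex ℝ U) (hf : ConvexOn ℝ U f)
    (hxU : ∀ k, x k ∈ U) (hx : IsBFGSSequence f x)
    (hlev : Bornology.IsBounded {z ∈ U | f z ≤ f (x 0)})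
    (hVo : IsOpen V) (hVU : V ⊆ U) (hxV : closure (Set.range x) ⊆ V)
    (hess : HasContinuousPosDefHessianOn f V)
    (hinf : sInf (f '' V) = sInf (f '' U)) :
    ∃ xmin ∈ U, IsMinOn f U xmin ∧ Tendsto (fun k => f (x k)) atTop (𝓝 (f xmin)) :=
  theorem2_general hf hx (hlev.subset (Set.range_subset_iff.2 fun k =>
    ⟨hxU k, hx.antitone (Nat.zero_le k)⟩)) hVo hVU hxV hess
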